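/- Consider the $\mu$HS equation $$-u_{txx}=-2\mu(u)u_x+2u_xu_{xx}+uu_{xxx},\qquad \mu(u)=\int_0^1u\,dx,$$ for $u=u(t,x)$ of period one in $x$. A \emph{period-one traveling wave of speed $c$} is a function $u(t,x)=\varphi(x-ct)$ where $\varphi\in H^1_{loc}(\mathbb R)$ is periodic with least period $1$ and, for some $a\in\mathbb R$, satisfies $\varphi_x^2=-4\mu(\varphi)\varphi+\left((\varphi-c)^2\right)_{xx}+a$ in the sense of distributions on $\mathbb R$. It is \emph{smooth} if $\varphi\in C^\infty(\mathbb R)$; then $u$ is a classical solution of the $\mu$HS equation. It is \emph{cusped} if $\max\varphi=c$, the maximum is attained exactly once per period, $\varphi$ is smooth away from the points where $\varphi=c$, and at each such point $x_0$ the function $\varphi$ is continuous with $\varphi_x\to+\infty$ as $x\uparrow x_0$ and $\varphi_x\to-\infty$ as $x\downarrow x_0$. A \emph{one-parameter family} of such waves is a family of profiles $\varphi_s$, $s\in(0,1)$, such that $(s,x)\mapsto\varphi_s(x)$ is continuous on $(0,1)\times\mathbb R$ and $\varphi_s$, $\varphi_{s'}$ are not translates of each other for $s\ne s'$. Theorem.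 For every real $c\neq0$ the $\mu$HS equation has a one-parameter family of smooth period-one traveling waves of speed $c$, and a one-parameter family of cusped period-one traveling waves of speed $c$. -/

import Mathlib

open Set Filter Topology MeasureTheory
open scoped ContDiff

namespace MuHS

/-- The mean `μ(f)` over the unit circle of a function `f` of period one. -/
noncomputable def mean (f : ℝ → ℝ) : ℝ := ∫ x in (0 : ℝ)..1, f x

/-- `ψ ∈ C_c^∞(ℝ)`. -/
def IsTestFunction (ψ : ℝ → ℝ) : Prop := ContDiff ℝ ∞ ψ ∧ HasCompactSupport ψ

/-- `f ∈ L²_loc(ℝ)`. -/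
def MemL2Loc (f : ℝ → ℝ) : Prop :=
  ∀ K : Set ℝ, IsCompact K → MemLp f 2 (volume.restrict K)

/-- `g` is the weak (distributional) derivative of `f`, both locally integrable. -/
def HasWeakDeriv (f g : ℝ → ℝ) : Prop :=
  LocallyIntegrable f ∧ LocallyIntegrable g ∧
    ∀ ψ : ℝ → ℝ, IsTestFunction ψ → ∫ x, f x * deriv ψ x = - ∫ x, g x * ψ x

/-- `φ ∈ H¹_loc(ℝ)` is the profile of a wave `φ (x - c t)` of speed `c` for the equation
`-u_txx = -2 μ u_x + 2 u_x u_xx + u u_xxx` with real parameter `μ`: for some `a`, the identity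
`φ_x² = -4 μ φ + ((φ - c)²)_xx + a` holds in the sense of distributions. -/
def IsTravelingWave (μ c : ℝ) (φ : ℝ → ℝ) : Prop :=
  ∃ φ' : ℝ → ℝ, MemL2Loc φ ∧ MemL2Loc φ' ∧ HasWeakDeriv φ φ' ∧
    ∃ a : ℝ, ∀ ψ : ℝ → ℝ, IsTestFunction ψ →
      ∫ x, φ' x ^ 2 * ψ x =
        (∫ x, (-4 * μ * φ x + a) * ψ x) + ∫ x, (φ x - c) ^ 2 * iteratedDeriv 2 ψ x

/-- A traveling wave of speed `c` of the μHS equation with least period one: the parameter `μ`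
is the mean of the profile. -/
def IsPeriodOneWave (c : ℝ) (φ : ℝ → ℝ) : Prop :=
  Function.Periodic φ 1 ∧ (∀ T : ℝ, 0 < T → T < 1 → ¬ Function.Periodic φ T) ∧
    IsTravelingWave (mean φ) c φ

/-- `u` is a smooth classical solution, for all times, on the circle `ℝ / ℤ`, of the μHS equation
`-u_txx = -2 μ(u) u_x + 2 u_x u_xx + u u_xxx`. -/
def IsClassicalSolution (u : ℝ → ℝ → ℝ) : Prop :=
  ContDiff ℝ ∞ (fun p : ℝ × ℝ => u p.1 p.2) ∧ (∀ t, Function.Periodic (u t) 1) ∧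
    ∀ t x : ℝ,
      - deriv (fun s => iteratedDeriv 2 (u s) x) t =
        -2 * mean (u t) * deriv (u t) x + 2 * deriv (u t) x * iteratedDeriv 2 (u t) x
          + u t x * iteratedDeriv 3 (u t) x

/-- A smooth period-one traveling wave of speed `c`. -/
def IsSmoothWave (c : ℝ) (φ : ℝ → ℝ) : Prop :=
  IsPeriodOneWave c φ ∧ ContDiff ℝ ∞ φ ∧ IsClassicalSolution (fun t x => φ (x - c * t))

/-- An (upward) cusp: `f` is continuous at `x₀`, smooth on both sides of `x₀`, and its slope tends
to `+∞` from the left and to `-∞` from the right. -/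
def HasCuspAt (f : ℝ → ℝ) (x₀ : ℝ) : Prop :=
  ContinuousAt f x₀ ∧
    (∃ ε > 0, ContDiffOn ℝ ∞ f (Ioo (x₀ - ε) x₀) ∧ ContDiffOn ℝ ∞ f (Ioo x₀ (x₀ + ε))) ∧
    Tendsto (deriv f) (𝓝[<] x₀) atTop ∧ Tendsto (deriv f) (𝓝[>] x₀) atBot

/-- A cusped period-one traveling wave of speed `c`: its maximum is `c`, it is attained exactly
once per period, in a cusp, and the profile is smooth away from the cusps. -/
def IsCuspedWave (c : ℝ) (φ : ℝ → ℝ) : Prop :=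
  IsPeriodOneWave c φ ∧ (∀ x, φ x ≤ c) ∧
    (∃ x₀ : ℝ, ∀ x, φ x = c ↔ ∃ n : ℤ, x = x₀ + n) ∧
    (∀ x, φ x = c → HasCuspAt φ x) ∧ ContDiffOn ℝ ∞ φ {x | φ x ≠ c}

/-- `Φ s`, `0 < s < 1`, is a (genuine) one-parameter family of profiles with property `P`: each
member has the property, `Φ s x` is jointly continuous in `(s, x)`, and no two members with
different parameters are translates of each other. -/
def IsOneParameterFamily (P : (ℝ → ℝ) → Prop) (Φ : ℝ → ℝ → ℝ) : Prop :=
  (∀ s ∈ Ioo (0 : ℝ) 1, P (Φ s)) ∧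
    ContinuousOn (fun p : ℝ × ℝ => Φ p.1 p.2) (Ioo (0 : ℝ) 1 ×ˢ univ) ∧
    ∀ s ∈ Ioo (0 : ℝ) 1, ∀ s' ∈ Ioo (0 : ℝ) 1, s ≠ s' →
      ¬ ∃ h : ℝ, ∀ x, Φ s' x = Φ s (x + h)

end MuHS

/-!
If `φ` solves the wave equation, then `c - φ` satisfies a first integral of the form
`φ_x ^ 2 * (c - φ) = Q (c - φ)` with a quadratic polynomial `Q`. A change of variables from `x` to a
phase `θ` makes both `c - φ` and `x` smooth functions of `θ`, even at a cusp: `c - φ` is a multiple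
of `a + b * sin θ ^ 2`, which oscillates between two roots of `Q` for a smooth wave, and between a
root and `0` for a cusped one. Scaling then normalizes the period to one and matches the remaining
coefficient with the mean of `φ`; the sign of the speed of a cusped wave is governed by the shape
parameter. Since `((φ - c) ^ 2)_x` extends continuously across the cusps, the differential equation
off the cusps implies the weak one by the fundamental theorem of calculus.
-/

open scoped Real

namespace MuHS

theorem integral_pos_of_countable_zeros {f : ℝ → ℝ} {a b : ℝ} (hab : a < b) (hf : Continuous f)
    (hnonneg : ∀ x, 0 ≤ f x) (hzeros : {x | f x = 0}.Countable) : 0 < ∫ x in a..b, f x := by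
  obtain ⟨x, hx, hfx⟩ : ∃ x ∈ Icc a b, f x ≠ 0 := by
    by_contra! h
    exact Cardinal.Real.Icc_countable_iff.not.2 (not_le.2 hab) (hzeros.mono h)
  exact intervalIntegral.integral_pos hab hf.continuousOn (fun x _ => hnonneg x)
    ⟨x, hx, (hnonneg x).lt_of_ne' hfx⟩

theorem mean_comp_add_const {f : ℝ → ℝ} (hf : Function.Periodic f 1) (h : ℝ) :
    mean (fun x => f (x + h)) = mean f := by
  simpa [mean, add_comm] using hf.intervalIntegral_add_eq h 0

theorem IsTestFunction.deriv {ψ : ℝ → ℝ} (hψ : IsTestFunction ψ) : IsTestFunction (deriv ψ) :=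
  ⟨(contDiff_infty_iff_deriv.1 hψ.1).2, hψ.2.deriv⟩

theorem IsTestFunction.integrable_mul {ψ f : ℝ → ℝ} (hψ : IsTestFunction ψ)
    (hf : LocallyIntegrable f) : Integrable fun x => f x * ψ x :=
  hf.integrable_smul_right_of_hasCompactSupport hψ.1.continuous hψ.2

theorem memL2Loc_of_continuous {f : ℝ → ℝ} (hf : Continuous f) : MemL2Loc f := fun K hK => by
  rw [memLp_two_iff_integrable_sq hf.aestronglyMeasurable]
  exact (hf.pow 2).continuousOn.integrableOn_compact hK

theorem MemL2Loc.locallyIntegrable {f : ℝ → ℝ} (hf : MemL2Loc f) : LocallyIntegrable f :=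
  locallyIntegrable_iff.2 fun K hK =>
    haveI : IsFiniteMeasure (volume.restrict K) := ⟨by simpa using hK.measure_lt_top⟩
    (hf K hK).integrable (by norm_num)

theorem MemL2Loc.locallyIntegrable_sq {f : ℝ → ℝ} (hf : MemL2Loc f) :
    LocallyIntegrable fun x => f x ^ 2 :=
  locallyIntegrable_iff.2 fun K hK => (hf K hK).integrable_sq

theorem hasWeakDeriv_of_hasDerivAt_off_countable {f f' : ℝ → ℝ} {s : Set ℝ} (hs : s.Countable)
    (hf : Continuous f) (hf' : LocallyIntegrable f') (hd : ∀ x ∉ s, HasDerivAt f (f' x) x) :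
    HasWeakDeriv f f' := by
  refine ⟨hf.locallyIntegrable, hf', fun ψ hψ => ?_⟩
  have hi : Integrable fun x => f x * deriv ψ x := hψ.deriv.integrable_mul hf.locallyIntegrable
  have hi' : Integrable fun x => f' x * ψ x := hψ.integrable_mul hf'
  obtain ⟨R, hR⟩ := hψ.2.isCompact.isBounded.subset_ball 0
  have hzero : ∀ x, R ≤ |x| → ψ x = 0 := fun x hx => image_eq_zero_of_notMem_tsupport fun h =>
    hx.not_gt (by simpa using hR h)
  have hsupp : Function.support (fun x => f' x * ψ x + f x * deriv ψ x) ⊆ Ioc (-R) R := by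
    intro x hx
    suffices |x| < R from ⟨(abs_lt.1 this).1, (abs_lt.1 this).2.le⟩
    suffices x ∈ tsupport ψ by simpa using hR this
    by_contra h
    simp [image_eq_zero_of_notMem_tsupport h,
      image_eq_zero_of_notMem_tsupport fun h' => h (tsupport_deriv_subset h')] at hx
  have htotal : ∫ x, (f' x * ψ x + f x * deriv ψ x) = 0 := by
    rw [← intervalIntegral.integral_eq_integral_of_support_subset hsupp,
      integral_eq_of_hasDerivAt_off_countable (fun x => f x * ψ x) _ hs
        (hf.mul hψ.1.continuous).continuousOn
        (fun x hx => (hd x hx.2).mul (hψ.1.differentiable (by simp) x).hasDerivAt)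
        (hi'.add hi).intervalIntegrable]
    simp [hzero, le_abs_self]
  rw [integral_add hi' hi] at htotal
  linarith

/-- The flux `r` extends `((φ - c)²)' = 2 (φ - c) φ'` continuously across the exceptional set. -/
theorem isTravelingWave_of_flux {μ c a : ℝ} {φ φ' r : ℝ → ℝ} {s : Set ℝ} (hs : s.Countable)
    (hφ : Continuous φ) (hφ' : MemL2Loc φ') (hr : Continuous r)
    (hd : ∀ x ∉ s, HasDerivAt φ (φ' x) x) (hflux : ∀ x ∉ s, r x = 2 * (φ x - c) * φ' x)
    (hdr : ∀ x ∉ s, HasDerivAt r (φ' x ^ 2 - (-4 * μ * φ x + a)) x) :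
    IsTravelingWave μ c φ := by
  have hlin : Continuous fun x => -4 * μ * φ x + a := by fun_prop
  have hweak : HasWeakDeriv φ φ' :=
    hasWeakDeriv_of_hasDerivAt_off_countable hs hφ hφ'.locallyIntegrable hd
  have hweak_sq : HasWeakDeriv (fun x => (φ x - c) ^ 2) r :=
    hasWeakDeriv_of_hasDerivAt_off_countable hs (by fun_prop) hr.locallyIntegrable fun x hx =>
      (((hd x hx).sub_const c).pow 2).congr_deriv (by rw [hflux x hx]; push_cast; ring)
  have hweak_flux : HasWeakDeriv r fun x => φ' x ^ 2 - (-4 * μ * φ x + a) :=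
    hasWeakDeriv_of_hasDerivAt_off_countable hs hr
      (hφ'.locallyIntegrable_sq.sub hlin.locallyIntegrable) hdr
  refine ⟨φ', memL2Loc_of_continuous hφ, hφ', hweak, a, fun ψ hψ => ?_⟩
  have htwice : ∫ x, (φ x - c) ^ 2 * iteratedDeriv 2 ψ x =
      ∫ x, (φ' x ^ 2 - (-4 * μ * φ x + a)) * ψ x := by
    rw [iteratedDeriv_succ, iteratedDeriv_one, hweak_sq.2.2 _ hψ.deriv, hweak_flux.2.2 _ hψ,
      neg_neg]
  simp only [htwice, sub_mul]
  rw [integral_sub (hψ.integrable_mul hφ'.locallyIntegrable_sq)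
    (hψ.integrable_mul hlin.locallyIntegrable)]
  ring

theorem isClassicalSolution_of_flux {φ : ℝ → ℝ} {c a : ℝ} (hφ : ContDiff ℝ ∞ φ)
    (hper : Function.Periodic φ 1)
    (hflux : ∀ x, HasDerivAt (fun y => 2 * (φ y - c) * deriv φ y)
      (deriv φ x ^ 2 - (-4 * mean φ * φ x + a)) x) :
    IsClassicalSolution fun t x => φ (x - c * t) := by
  have hD : ∀ n x, HasDerivAt (iteratedDeriv n φ) (iteratedDeriv (n + 1) φ x) x := fun n x => by
    rw [iteratedDeriv_succ]
    exact (hφ.differentiable_iteratedDeriv n (by exact_mod_cast WithTop.coe_lt_top n) x).hasDerivAt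
  have hD₀ : ∀ x, HasDerivAt φ (deriv φ x) x := fun x => by simpa using hD 0 x
  have hD₁ : ∀ x, HasDerivAt (deriv φ) (iteratedDeriv 2 φ x) x := fun x => by simpa using hD 1 x
  have hode : ∀ x, deriv φ x ^ 2 + 2 * (φ x - c) * iteratedDeriv 2 φ x =
      4 * mean φ * φ x - a := fun x => by
    linear_combination
      ((((hD₀ x).sub_const c).const_mul 2).mul (hD₁ x)).unique (hflux x)
  have hode' : ∀ x, 4 * deriv φ x * iteratedDeriv 2 φ x + 2 * (φ x - c) * iteratedDeriv 3 φ x =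
      4 * mean φ * deriv φ x := fun x => by
    have h := (((hD₁ x).pow 2).add ((((hD₀ x).sub_const c).const_mul 2).mul (hD 2 x))).unique
      ((((hD₀ x).const_mul (4 * mean φ)).sub_const a).congr_of_eventuallyEq (.of_forall hode))
    push_cast at h
    linear_combination h
  refine ⟨hφ.comp (contDiff_snd.sub (contDiff_const.mul contDiff_fst)), fun t => ?_, fun t x => ?_⟩
  · exact hper.sub_const (c * t)
  · have hmean : mean (fun x => φ (x - c * t)) = mean φ := by
      simpa only [← sub_eq_add_neg] using mean_comp_add_const hper (-(c * t))
    have htime : HasDerivAt (fun s => iteratedDeriv 2 φ (x - c * s))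
        (iteratedDeriv 3 φ (x - c * t) * -c) t :=
      HasDerivAt.comp (h₂ := iteratedDeriv 2 φ) t (hD 2 (x - c * t))
        (by simpa using ((hasDerivAt_id t).const_mul c).const_sub x)
    simp only [iteratedDeriv_comp_sub_const, deriv_comp_sub_const, hmean, htime.deriv]
    linear_combination (-1 / 2 : ℝ) * hode' (x - c * t)

theorem HasCuspAt.comp_sub_const {f : ℝ → ℝ} {x₀ : ℝ} (h : HasCuspAt f x₀) (y : ℝ) :
    HasCuspAt (fun x => f (x - y)) (x₀ + y) := by
  obtain ⟨hcont, ⟨ε, hε, hleft, hright⟩, hL, hR⟩ := h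
  have hsub : Tendsto (fun x => x - y) (𝓝 (x₀ + y)) (𝓝 x₀) := by
    simpa using (continuous_sub_right y).tendsto (x₀ + y)
  have hdiff : ContDiff ℝ ∞ fun x => x - y := contDiff_id.sub contDiff_const
  refine ⟨?_, ⟨ε, hε, hleft.comp hdiff.contDiffOn ?_, hright.comp hdiff.contDiffOn ?_⟩, ?_, ?_⟩
  · simpa [ContinuousAt, Function.comp_def] using hcont.tendsto.comp hsub
  · rintro x ⟨h₁, h₂⟩
    constructor <;> linarith
  · rintro x ⟨h₁, h₂⟩
    constructor <;> linarith
  · simp only [funext fun x => deriv_comp_sub_const f y x]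
    exact hL.comp (hsub.inf <|
      tendsto_principal_principal.2 fun _ => sub_lt_iff_lt_add.2 ∘ mem_Iio.1)
  · simp only [funext fun x => deriv_comp_sub_const f y x]
    exact hR.comp (hsub.inf <|
      tendsto_principal_principal.2 fun _ => lt_sub_iff_add_lt.2 ∘ mem_Ioi.1)

theorem continuousOn_prod_univ {X Y Z : Type*} [TopologicalSpace X] [TopologicalSpace Y]
    [TopologicalSpace Z] {f : X → Y → Z} {s : Set X}
    (hf : Continuous fun p : s × Y => f p.1 p.2) :
    ContinuousOn (fun p : X × Y => f p.1 p.2) (s ×ˢ univ) := by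
  rw [continuousOn_iff_continuous_domRestrict]
  exact hf.comp (show Continuous fun p : ↥(s ×ˢ (univ : Set Y)) =>
    ((⟨p.1.1, p.2.1⟩, p.1.2) : s × Y) by fun_prop)

/-- A smooth nonnegative `π`-periodic density of total mass one per period, with only countably
many zeros. Its primitive reparametrizes the line. -/
structure IsClock (g : ℝ → ℝ) : Prop where
  contDiff : ContDiff ℝ ∞ g
  nonneg : ∀ θ, 0 ≤ g θ
  countable_zeros : {θ | g θ = 0}.Countable
  periodic : Function.Periodic g π
  integral_eq_one : ∫ θ in (0 : ℝ)..π, g θ = 1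

/-- The position on the line at which a wave with density `g` has phase `θ`. -/
noncomputable def clock (g : ℝ → ℝ) (θ : ℝ) : ℝ := ∫ t in (0 : ℝ)..θ, g t

/-- The phase at a position, inverse to `clock g`. It is meaningful only if `g` is a clock, since
`Function.invFun` takes arbitrary values outside the range. -/
noncomputable def phase (g : ℝ → ℝ) : ℝ → ℝ := Function.invFun (clock g)

namespace IsClock

variable {g : ℝ → ℝ}

theorem continuous (hg : IsClock g) : Continuous g := hg.contDiff.continuous

theorem hasDerivAt_clock (hg : IsClock g) (θ : ℝ) : HasDerivAt (clock g) (g θ) θ :=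
  hg.continuous.integral_hasStrictDerivAt 0 θ |>.hasDerivAt

theorem continuous_clock (hg : IsClock g) : Continuous (clock g) :=
  continuous_iff_continuousAt.2 fun θ => (hg.hasDerivAt_clock θ).continuousAt

theorem contDiff_clock (hg : IsClock g) : ContDiff ℝ ∞ (clock g) := by
  rw [contDiff_infty_iff_deriv, funext fun θ => (hg.hasDerivAt_clock θ).deriv]
  exact ⟨fun θ => (hg.hasDerivAt_clock θ).differentiableAt, hg.contDiff⟩

theorem strictMono_clock (hg : IsClock g) : StrictMono (clock g) := fun a b hab => by
  rw [← sub_pos, clock, clock, intervalIntegral.integral_interval_sub_left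
    (hg.continuous.intervalIntegrable 0 b) (hg.continuous.intervalIntegrable 0 a)]
  exact integral_pos_of_countable_zeros hab hg.continuous hg.nonneg hg.countable_zeros

theorem surjective_clock (hg : IsClock g) : Function.Surjective (clock g) := by
  have hmass : 0 < ∫ θ in (0 : ℝ)..π, g θ := by rw [hg.integral_eq_one]; exact one_pos
  exact hg.continuous_clock.surjective
    (hg.periodic.tendsto_atTop_intervalIntegral_of_pos hmass Real.pi_pos)
    (hg.periodic.tendsto_atBot_intervalIntegral_of_pos hmass Real.pi_pos)

theorem clock_add_pi (hg : IsClock g) (θ : ℝ) : clock g (θ + π) = clock g θ + 1 := by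
  simpa [clock, hg.integral_eq_one] using
    hg.periodic.intervalIntegral_add_eq_add 0 θ hg.continuous.intervalIntegrable

theorem clock_phase (hg : IsClock g) (x : ℝ) : clock g (phase g x) = x :=
  Function.rightInverse_invFun hg.surjective_clock x

theorem phase_clock (hg : IsClock g) (θ : ℝ) : phase g (clock g θ) = θ :=
  Function.leftInverse_invFun hg.strictMono_clock.injective θ

theorem phase_zero (hg : IsClock g) : phase g 0 = 0 := by
  simpa [clock] using hg.phase_clock 0

theorem phase_add_one (hg : IsClock g) (x : ℝ) : phase g (x + 1) = phase g x + π := by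
  rw [← hg.phase_clock (phase g x + π), hg.clock_add_pi, hg.clock_phase]

theorem phase_lt_iff (hg : IsClock g) {x θ : ℝ} : phase g x < θ ↔ x < clock g θ := by
  rw [← hg.strictMono_clock.lt_iff_lt, hg.clock_phase]

theorem lt_phase_iff (hg : IsClock g) {x θ : ℝ} : θ < phase g x ↔ clock g θ < x := by
  rw [← hg.strictMono_clock.lt_iff_lt, hg.clock_phase]

theorem strictMono_phase (hg : IsClock g) : StrictMono (phase g) := fun x y h => by
  rwa [hg.phase_lt_iff, hg.clock_phase]

theorem surjective_phase (hg : IsClock g) : Function.Surjective (phase g) :=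
  fun θ => ⟨clock g θ, hg.phase_clock θ⟩

theorem continuous_phase (hg : IsClock g) : Continuous (phase g) :=
  hg.strictMono_phase.monotone.continuous_of_surjective hg.surjective_phase

/-- The clock as a homeomorphism of the line, with inverse the phase. -/
noncomputable def homeomorph (hg : IsClock g) : ℝ ≃ₜ ℝ where
  toFun := clock g
  invFun := phase g
  left_inv := hg.phase_clock
  right_inv := hg.clock_phase
  continuous_toFun := hg.continuous_clock
  continuous_invFun := hg.continuous_phase

theorem tendsto_phase_nhdsLT_zero (hg : IsClock g) : Tendsto (phase g) (𝓝[<] 0) (𝓝[<] 0) := by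
  have h := hg.continuous_phase.continuousWithinAt.tendsto_nhdsWithin (x := 0) (s := Iio 0)
    (t := Iio (phase g 0)) fun x hx => hg.strictMono_phase hx
  rwa [hg.phase_zero] at h

theorem tendsto_phase_nhdsGT_zero (hg : IsClock g) : Tendsto (phase g) (𝓝[>] 0) (𝓝[>] 0) := by
  have h := hg.continuous_phase.continuousWithinAt.tendsto_nhdsWithin (x := 0) (s := Ioi 0)
    (t := Ioi (phase g 0)) fun x hx => hg.strictMono_phase hx
  rwa [hg.phase_zero] at h

theorem hasDerivAt_phase (hg : IsClock g) {x : ℝ} (hx : g (phase g x) ≠ 0) :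
    HasDerivAt (phase g) (g (phase g x))⁻¹ x :=
  HasDerivAt.of_local_left_inverse hg.continuous_phase.continuousAt (hg.hasDerivAt_clock _) hx
    (.of_forall hg.clock_phase)

theorem contDiffAt_phase (hg : IsClock g) {x : ℝ} (hx : g (phase g x) ≠ 0) :
    ContDiffAt ℝ ∞ (phase g) x :=
  hg.homeomorph.toOpenPartialHomeomorph.contDiffAt_symm_deriv hx (mem_univ x)
    (hg.hasDerivAt_clock _) hg.contDiff_clock.contDiffAt

theorem countable_setOf_phase_eq_zero (hg : IsClock g) : {x | g (phase g x) = 0}.Countable :=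
  hg.countable_zeros.preimage hg.strictMono_phase.injective

theorem integrableOn_iff (hg : IsClock g) (f : ℝ → ℝ) {K : Set ℝ} (hK : MeasurableSet K) :
    IntegrableOn f K ↔ IntegrableOn (fun θ => f (clock g θ) * g θ) (clock g ⁻¹' K) := by
  have h := integrableOn_image_iff_integrableOn_abs_deriv_smul (F := ℝ)
    (hg.continuous_clock.measurable hK)
    (fun θ _ => (hg.hasDerivAt_clock θ).hasDerivWithinAt) hg.strictMono_clock.injective.injOn f
  rw [image_preimage_eq _ hg.surjective_clock] at h
  simpa [abs_of_nonneg (hg.nonneg _), mul_comm] using h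

theorem mean_comp_phase (hg : IsClock g) {F : ℝ → ℝ} (hF : Continuous F) :
    mean (F ∘ phase g) = ∫ θ in (0 : ℝ)..π, F θ * g θ := by
  have h := intervalIntegral.integral_comp_mul_deriv (a := 0) (b := π)
    (fun θ _ => hg.hasDerivAt_clock θ) hg.continuous.continuousOn (hF.comp hg.continuous_phase)
  have hpi : clock g π = 1 := by simpa [clock] using hg.clock_add_pi 0
  rw [hpi, show clock g 0 = 0 by simp [clock]] at h
  simpa [mean, hg.phase_clock] using h.symm

/-- The weight `g` in the change of variables absorbs the singularities of `P`. -/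
theorem memL2Loc_comp_phase (hg : IsClock g) {P G : ℝ → ℝ} (hP : Measurable P)
    (hG : Continuous G) (h : ∀ θ, g θ ≠ 0 → P θ ^ 2 * g θ = G θ) : MemL2Loc (P ∘ phase g) := by
  intro K hK
  rw [memLp_two_iff_integrable_sq (hP.comp hg.continuous_phase.measurable).aestronglyMeasurable]
  refine (hg.integrableOn_iff _ hK.measurableSet).2 ?_
  simp only [Function.comp_apply, hg.phase_clock]
  refine (hG.continuousOn.integrableOn_compact
    (hg.homeomorph.isCompact_preimage.2 hK)).congr_fun_ae (ae_restrict_of_ae ?_)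
  filter_upwards [hg.countable_zeros.ae_notMem volume] with θ hθ using (h θ hθ).symm

theorem periodic_comp_phase (hg : IsClock g) {F : ℝ → ℝ} (hF : Function.Periodic F π) :
    Function.Periodic (F ∘ phase g) 1 := fun x => by
  simp only [Function.comp_apply, hg.phase_add_one, hF (phase g x)]

theorem phase_int (hg : IsClock g) (n : ℤ) : phase g n = n * π := by
  have h : Function.Periodic (fun x => phase g x - x * π) 1 := fun x => by
    simp only [hg.phase_add_one]
    ring
  simpa [hg.phase_zero, sub_eq_zero] using h.int_mul_eq n

theorem sin_phase_eq_zero_iff (hg : IsClock g) {x : ℝ} :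
    Real.sin (phase g x) = 0 ↔ ∃ n : ℤ, x = n := by
  simp only [Real.sin_eq_zero_iff, ← hg.phase_int, hg.strictMono_phase.injective.eq_iff]
  exact exists_congr fun n => eq_comm

theorem not_periodic_comp_phase (hg : IsClock g) {F : ℝ → ℝ}
    (hF : ∀ θ, F θ = F 0 → Real.sin θ = 0) {T : ℝ} (hT₀ : 0 < T) (hT₁ : T < 1) :
    ¬ Function.Periodic (F ∘ phase g) T := fun h => by
  obtain ⟨n, rfl⟩ := hg.sin_phase_eq_zero_iff.1 <| hF (phase g T) <| by
    simpa [hg.phase_zero] using h 0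
  have : (0 : ℤ) < n := by exact_mod_cast hT₀
  have : n < (1 : ℤ) := by exact_mod_cast hT₁
  omega

end IsClock

theorem continuous_phase_uncurry {X : Type*} [TopologicalSpace X] {G : X → ℝ → ℝ}
    (hG : ∀ s, IsClock (G s)) (hclock : ∀ θ, Continuous fun s => clock (G s) θ) :
    Continuous fun p : X × ℝ => phase (G p.1) p.2 := by
  refine OrderTopology.continuous_iff.2 fun θ => ⟨?_, ?_⟩
  · simp only [preimage, mem_Ioi, (hG _).lt_phase_iff]
    exact isOpen_lt ((hclock θ).comp continuous_fst) continuous_snd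
  · simp only [preimage, mem_Iio, (hG _).phase_lt_iff]
    exact isOpen_lt continuous_snd ((hclock θ).comp continuous_fst)

/-- A wave described by its phase `θ`: up to scaling, `c - φ` is the function `height` of `θ` and
`dx = height / √weight dθ`. The constants are the coefficients of the first integral. -/
structure WaveData where
  height : ℝ → ℝ
  weight : ℝ → ℝ
  e₀ : ℝ
  e₁ : ℝ
  κ : ℝ

namespace WaveData

/-- The right-hand side `Q` of the first integral `φ_x ^ 2 * (c - φ) = Q (c - φ)`, up to scaling. -/
def energy (w : WaveData) (y : ℝ) : ℝ := w.e₀ + w.e₁ * y - 4 * w.κ * y ^ 2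

/-- The conditions under which the phase description yields a traveling wave for every speed for
which it can be scaled. Zeros of the height, where the wave may be singular, are allowed. -/
structure IsAdmissible (w : WaveData) : Prop where
  contDiff_height : ContDiff ℝ ∞ w.height
  contDiff_weight : ContDiff ℝ ∞ w.weight
  periodic_height : Function.Periodic w.height π
  periodic_weight : Function.Periodic w.weight π
  height_nonneg : ∀ θ, 0 ≤ w.height θ
  weight_pos : ∀ θ, 0 < w.weight θ
  countable_critical : {θ | deriv w.height θ = 0}.Countable
  firstIntegral : ∀ θ,
    deriv w.height θ ^ 2 * w.weight θ = w.height θ * w.energy (w.height θ)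

/-- The unnormalized density of the position with respect to the phase. -/
noncomputable def density (w : WaveData) (θ : ℝ) : ℝ := w.height θ / √(w.weight θ)

/-- The length of one period before it is normalized to one. -/
noncomputable def mass (w : WaveData) : ℝ := ∫ θ in (0 : ℝ)..π, w.density θ

/-- The integral of the height over one period before normalization. -/
noncomputable def moment (w : WaveData) : ℝ := ∫ θ in (0 : ℝ)..π, w.height θ * w.density θ

/-- The density of the position with respect to the phase, for a wave of period one. -/
noncomputable def rate (w : WaveData) (θ : ℝ) : ℝ := w.density θ / w.mass

/-- The speed for which `c - φ` is the height itself. -/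
noncomputable def unitSpeed (w : WaveData) : ℝ := 2 * w.κ * w.mass ^ 2 + w.moment / w.mass

/-- The factor between `c - φ` and the height for a wave of speed `c`; it is meaningful only for
data of nonzero unit speed. -/
noncomputable def scale (w : WaveData) (c : ℝ) : ℝ := c / w.unitSpeed

/-- The profile of the wave of speed `c`. -/
noncomputable def profile (w : WaveData) (c : ℝ) : ℝ → ℝ :=
  (fun θ => c - w.scale c * w.height θ) ∘ phase w.rate

/-- The slope `φ_x` of the profile as a function of the phase, off the zeros of the height. -/
noncomputable def slope (w : WaveData) (c θ : ℝ) : ℝ :=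
  -(w.scale c * w.mass * deriv w.height θ * √(w.weight θ) / w.height θ)

/-- The flux `((φ - c) ^ 2)_x` of the profile as a function of the phase. -/
noncomputable def flux (w : WaveData) (c θ : ℝ) : ℝ :=
  2 * w.scale c ^ 2 * w.mass * deriv w.height θ * √(w.weight θ)

theorem inv_rate (w : WaveData) (θ : ℝ) : (w.rate θ)⁻¹ = w.mass * √(w.weight θ) / w.height θ := by
  simp [rate, density, div_eq_mul_inv, mul_comm, mul_left_comm]

theorem flux_eq (w : WaveData) (c : ℝ) {θ : ℝ} (hθ : w.height θ ≠ 0) :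
    w.flux c θ = 2 * (c - w.scale c * w.height θ - c) * w.slope c θ := by
  rw [flux, slope]
  field_simp
  ring

namespace IsAdmissible

variable {w : WaveData}

theorem countable_zeros (hw : w.IsAdmissible) : {θ | w.height θ = 0}.Countable := by
  refine hw.countable_critical.mono fun θ (hθ : w.height θ = 0) => IsLocalMin.deriv_eq_zero ?_
  exact .of_forall fun θ' => hθ.trans_le (hw.height_nonneg θ')

theorem sqrt_weight_pos (hw : w.IsAdmissible) (θ : ℝ) : 0 < √(w.weight θ) :=
  Real.sqrt_pos.2 (hw.weight_pos θ)

theorem hasDerivAt_height (hw : w.IsAdmissible) (θ : ℝ) :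
    HasDerivAt w.height (deriv w.height θ) θ :=
  (hw.contDiff_height.differentiable (by simp) θ).hasDerivAt

theorem hasDerivAt_weight (hw : w.IsAdmissible) (θ : ℝ) :
    HasDerivAt w.weight (deriv w.weight θ) θ :=
  (hw.contDiff_weight.differentiable (by simp) θ).hasDerivAt

theorem contDiff_deriv_height (hw : w.IsAdmissible) : ContDiff ℝ ∞ (deriv w.height) :=
  (contDiff_infty_iff_deriv.1 hw.contDiff_height).2

theorem hasDerivAt_deriv_height (hw : w.IsAdmissible) (θ : ℝ) :
    HasDerivAt (deriv w.height) (iteratedDeriv 2 w.height θ) θ := by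
  rw [iteratedDeriv_succ, iteratedDeriv_one]
  exact (hw.contDiff_deriv_height.differentiable (by simp) θ).hasDerivAt

/-- Differentiating the first integral gives this identity times `deriv w.height θ`, which vanishes
only on a null set. -/
theorem height_equation (hw : w.IsAdmissible) (θ : ℝ) :
    2 * iteratedDeriv 2 w.height θ * w.weight θ + deriv w.height θ * deriv w.weight θ =
      w.e₀ + 2 * w.e₁ * w.height θ - 12 * w.κ * w.height θ ^ 2 := by
  have hcont : Continuous fun θ =>
      2 * iteratedDeriv 2 w.height θ * w.weight θ + deriv w.height θ * deriv w.weight θ := by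
    have := hw.contDiff_height.continuous_iteratedDeriv 2 (by norm_cast)
    have := hw.contDiff_deriv_height.continuous
    have := hw.contDiff_weight.continuous
    have := hw.contDiff_weight.continuous_deriv (by simp)
    fun_prop
  have hcont' : Continuous fun θ =>
      w.e₀ + 2 * w.e₁ * w.height θ - 12 * w.κ * w.height θ ^ 2 := by
    have := hw.contDiff_height.continuous
    fun_prop
  refine congr_fun ((hcont.ae_eq_iff_eq volume hcont').1 ?_) θ
  filter_upwards [hw.countable_critical.ae_notMem volume] with θ hθ
  have hleft := ((hw.hasDerivAt_deriv_height θ).pow 2).mul (hw.hasDerivAt_weight θ)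
  have hright := (hw.hasDerivAt_height θ).mul <|
    (((hw.hasDerivAt_height θ).const_mul w.e₁).const_add w.e₀).sub
      (((hw.hasDerivAt_height θ).pow 2).const_mul (4 * w.κ))
  have h := hleft.unique (hright.congr_of_eventuallyEq (.of_forall hw.firstIntegral))
  refine mul_left_cancel₀ hθ ?_
  push_cast at h
  simp only [Pi.sub_apply, Pi.pow_apply] at h
  linear_combination h

theorem contDiff_sqrt_weight (hw : w.IsAdmissible) : ContDiff ℝ ∞ fun θ => √(w.weight θ) :=
  hw.contDiff_weight.sqrt fun θ => (hw.weight_pos θ).ne'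

theorem contDiff_density (hw : w.IsAdmissible) : ContDiff ℝ ∞ w.density :=
  hw.contDiff_height.div hw.contDiff_sqrt_weight fun θ => (hw.sqrt_weight_pos θ).ne'

theorem density_nonneg (hw : w.IsAdmissible) (θ : ℝ) : 0 ≤ w.density θ :=
  div_nonneg (hw.height_nonneg θ) (Real.sqrt_nonneg _)

theorem density_eq_zero_iff (hw : w.IsAdmissible) {θ : ℝ} :
    w.density θ = 0 ↔ w.height θ = 0 := by
  simp [density, (hw.sqrt_weight_pos θ).ne']

theorem mass_pos (hw : w.IsAdmissible) : 0 < w.mass :=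
  integral_pos_of_countable_zeros Real.pi_pos hw.contDiff_density.continuous hw.density_nonneg
    (by simpa only [hw.density_eq_zero_iff] using hw.countable_zeros)

theorem moment_pos (hw : w.IsAdmissible) : 0 < w.moment :=
  integral_pos_of_countable_zeros Real.pi_pos
    (hw.contDiff_height.continuous.mul hw.contDiff_density.continuous)
    (fun θ => mul_nonneg (hw.height_nonneg θ) (hw.density_nonneg θ))
    (by simpa only [mul_eq_zero, hw.density_eq_zero_iff, or_self] using hw.countable_zeros)

theorem rate_ne_zero_iff (hw : w.IsAdmissible) {θ : ℝ} : w.rate θ ≠ 0 ↔ w.height θ ≠ 0 := by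
  simp [rate, hw.mass_pos.ne', hw.density_eq_zero_iff]

theorem unitSpeed_pos (hw : w.IsAdmissible) (hκ : 0 ≤ w.κ) : 0 < w.unitSpeed := by
  have hmass := hw.mass_pos
  have hmoment := hw.moment_pos
  unfold unitSpeed
  positivity

theorem isClock (hw : w.IsAdmissible) : IsClock w.rate where
  contDiff := hw.contDiff_density.div_const _
  nonneg θ := div_nonneg (hw.density_nonneg θ) hw.mass_pos.le
  countable_zeros := by
    simpa [rate, hw.mass_pos.ne', hw.density_eq_zero_iff] using hw.countable_zeros
  periodic θ := by simp only [rate, density, hw.periodic_height θ, hw.periodic_weight θ]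
  integral_eq_one := by
    simp only [rate, intervalIntegral.integral_div]
    exact div_self hw.mass_pos.ne'

theorem continuous_profile (hw : w.IsAdmissible) (c : ℝ) : Continuous (w.profile c) :=
  (continuous_const.sub (continuous_const.mul hw.contDiff_height.continuous)).comp
    hw.isClock.continuous_phase

theorem periodic_profile (hw : w.IsAdmissible) (c : ℝ) : Function.Periodic (w.profile c) 1 :=
  hw.isClock.periodic_comp_phase fun θ => by rw [hw.periodic_height θ]

theorem mean_profile (hw : w.IsAdmissible) {c : ℝ} (hunit : w.unitSpeed ≠ 0) :
    mean (w.profile c) = 2 * w.κ * w.scale c * w.mass ^ 2 := by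
  have hcont := hw.contDiff_height.continuous
  have hrate := hw.isClock.continuous
  have hmoment : ∫ θ in (0 : ℝ)..π, w.height θ * w.rate θ = w.moment / w.mass := by
    simp only [rate, mul_div_assoc', intervalIntegral.integral_div, moment]
  have hspeed : w.scale c * w.unitSpeed = c := div_mul_cancel₀ c hunit
  rw [profile, hw.isClock.mean_comp_phase (by fun_prop)]
  simp only [sub_mul, mul_assoc]
  rw [intervalIntegral.integral_sub (Continuous.intervalIntegrable (by fun_prop) _ _)
    (Continuous.intervalIntegrable (by fun_prop) _ _)]
  simp only [intervalIntegral.integral_const_mul, hw.isClock.integral_eq_one, hmoment]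
  rw [unitSpeed] at hspeed
  linear_combination -hspeed

theorem contDiffAt_profile (hw : w.IsAdmissible) (c : ℝ) {x : ℝ}
    (hx : w.height (phase w.rate x) ≠ 0) : ContDiffAt ℝ ∞ (w.profile c) x :=
  (contDiff_const.sub (contDiff_const.mul hw.contDiff_height)).contDiffAt.comp x
    (hw.isClock.contDiffAt_phase (hw.rate_ne_zero_iff.2 hx))

theorem hasDerivAt_profile (hw : w.IsAdmissible) (c : ℝ) {x : ℝ}
    (hx : w.height (phase w.rate x) ≠ 0) :
    HasDerivAt (w.profile c) (w.slope c (phase w.rate x)) x := by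
  refine ((((hw.hasDerivAt_height _).const_mul (w.scale c)).const_sub c).comp x
    (hw.isClock.hasDerivAt_phase (hw.rate_ne_zero_iff.2 hx))).congr_deriv ?_
  rw [inv_rate, slope]
  ring

theorem slope_sq (hw : w.IsAdmissible) (c : ℝ) {θ : ℝ} (hθ : w.height θ ≠ 0) :
    w.slope c θ ^ 2 = (w.scale c * w.mass) ^ 2 * w.energy (w.height θ) / w.height θ := by
  have hsqrt := Real.sq_sqrt (hw.weight_pos θ).le
  rw [slope, neg_sq, div_pow, mul_pow, hsqrt, mul_pow, mul_assoc, hw.firstIntegral]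
  field_simp

theorem height_mul_sq_deriv_profile (hw : w.IsAdmissible) (c : ℝ) {x : ℝ}
    (hx : w.height (phase w.rate x) ≠ 0) :
    w.height (phase w.rate x) * deriv (w.profile c) x ^ 2 =
      (w.scale c * w.mass) ^ 2 * w.energy (w.height (phase w.rate x)) := by
  rw [(hw.hasDerivAt_profile c hx).deriv, hw.slope_sq c hx, mul_div_cancel₀ _ hx]

theorem continuous_flux (hw : w.IsAdmissible) (c : ℝ) : Continuous (w.flux c) :=
  (hw.contDiff_deriv_height.continuous.const_mul _).mul hw.contDiff_sqrt_weight.continuous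

theorem hasDerivAt_flux (hw : w.IsAdmissible) (c θ : ℝ) :
    HasDerivAt (w.flux c) (w.scale c ^ 2 * w.mass / √(w.weight θ) *
      (w.e₀ + 2 * w.e₁ * w.height θ - 12 * w.κ * w.height θ ^ 2)) θ := by
  have hsqrt := Real.sq_sqrt (hw.weight_pos θ).le
  have hne := (hw.sqrt_weight_pos θ).ne'
  refine (((hw.hasDerivAt_deriv_height θ).const_mul (2 * w.scale c ^ 2 * w.mass)).mul
    ((hw.hasDerivAt_weight θ).sqrt (hw.weight_pos θ).ne')).congr_deriv ?_
  rw [← hw.height_equation]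
  field_simp
  rw [hsqrt]

theorem hasDerivAt_flux_phase (hw : w.IsAdmissible) {c : ℝ} (hunit : w.unitSpeed ≠ 0) {x : ℝ}
    (hx : w.height (phase w.rate x) ≠ 0) :
    HasDerivAt (w.flux c ∘ phase w.rate) (w.slope c (phase w.rate x) ^ 2 -
      (-4 * mean (w.profile c) * w.profile c x +
        (4 * mean (w.profile c) * c - (w.scale c * w.mass) ^ 2 * w.e₁))) x := by
  have hne := (hw.sqrt_weight_pos (phase w.rate x)).ne'
  refine ((hw.hasDerivAt_flux c _).comp x
    (hw.isClock.hasDerivAt_phase (hw.rate_ne_zero_iff.2 hx))).congr_deriv ?_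
  rw [inv_rate, hw.slope_sq c hx, hw.mean_profile hunit, profile, Function.comp_apply, energy]
  field_simp
  ring

theorem slope_sq_mul_rate (hw : w.IsAdmissible) (c : ℝ) {θ : ℝ} (hθ : w.height θ ≠ 0) :
    w.slope c θ ^ 2 * w.rate θ =
      w.scale c ^ 2 * w.mass * w.energy (w.height θ) / √(w.weight θ) := by
  have hmass := hw.mass_pos.ne'
  have hne := (hw.sqrt_weight_pos θ).ne'
  rw [hw.slope_sq c hθ, rate, density]
  field_simp

theorem memL2Loc_slope_phase (hw : w.IsAdmissible) (c : ℝ) :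
    MemL2Loc (w.slope c ∘ phase w.rate) := by
  have hheight := hw.contDiff_height.continuous
  have hderiv := hw.contDiff_deriv_height.continuous
  have hsqrt := hw.contDiff_sqrt_weight.continuous
  refine hw.isClock.memL2Loc_comp_phase ?_ ?_ fun θ hθ =>
    hw.slope_sq_mul_rate c (hw.rate_ne_zero_iff.1 hθ)
  · exact (((hderiv.const_mul _).mul hsqrt).measurable.div hheight.measurable).neg
  · refine Continuous.div ?_ hsqrt fun θ => (hw.sqrt_weight_pos θ).ne'
    simp only [energy]
    fun_prop

theorem isTravelingWave_profile (hw : w.IsAdmissible) {c : ℝ} (hunit : w.unitSpeed ≠ 0) :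
    IsTravelingWave (mean (w.profile c)) c (w.profile c) := by
  refine isTravelingWave_of_flux hw.isClock.countable_setOf_phase_eq_zero
    (hw.continuous_profile c) (hw.memL2Loc_slope_phase c)
    ((hw.continuous_flux c).comp hw.isClock.continuous_phase) (fun x hx => ?_) (fun x hx => ?_)
    fun x hx => hw.hasDerivAt_flux_phase hunit (hw.rate_ne_zero_iff.1 hx)
  · exact hw.hasDerivAt_profile c (hw.rate_ne_zero_iff.1 hx)
  · exact w.flux_eq c (hw.rate_ne_zero_iff.1 hx)

theorem isPeriodOneWave_profile (hw : w.IsAdmissible) {c : ℝ} (hc : c ≠ 0)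
    (hunit : w.unitSpeed ≠ 0) (hmin : ∀ θ, w.height θ = w.height 0 → Real.sin θ = 0) :
    IsPeriodOneWave c (w.profile c) := by
  refine ⟨hw.periodic_profile c, fun T hT₀ hT₁ => ?_, hw.isTravelingWave_profile hunit⟩
  refine hw.isClock.not_periodic_comp_phase (fun θ hθ => hmin θ ?_) hT₀ hT₁
  have hscale : w.scale c ≠ 0 := div_ne_zero hc hunit
  simpa [hscale] using hθ

theorem isSmoothWave_profile (hw : w.IsAdmissible) {c : ℝ} (hc : c ≠ 0)
    (hunit : w.unitSpeed ≠ 0) (hmin : ∀ θ, w.height θ = w.height 0 → Real.sin θ = 0)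
    (hpos : ∀ θ, 0 < w.height θ) : IsSmoothWave c (w.profile c) := by
  have hne : ∀ x, w.height (phase w.rate x) ≠ 0 := fun x => (hpos _).ne'
  have hderiv : ∀ x, deriv (w.profile c) x = w.slope c (phase w.rate x) := fun x =>
    (hw.hasDerivAt_profile c (hne x)).deriv
  have hflux : (fun x => 2 * (w.profile c x - c) * deriv (w.profile c) x) =
      w.flux c ∘ phase w.rate := funext fun x => by
    rw [hderiv]
    exact (w.flux_eq c (hne x)).symm
  have hsmooth : ContDiff ℝ ∞ (w.profile c) :=
    contDiff_iff_contDiffAt.2 fun x => hw.contDiffAt_profile c (hne x)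
  refine ⟨hw.isPeriodOneWave_profile hc hunit hmin, hsmooth,
    isClassicalSolution_of_flux (a := 4 * mean (w.profile c) * c - (w.scale c * w.mass) ^ 2 * w.e₁)
      hsmooth (hw.periodic_profile c) fun x => ?_⟩
  rw [hflux, hderiv]
  exact hw.hasDerivAt_flux_phase hunit (hne x)

end IsAdmissible

theorem continuous_profile_uncurry {X : Type*} [TopologicalSpace X]
    {w : X → WaveData} (hw : ∀ s, (w s).IsAdmissible) (hunit : ∀ s, (w s).unitSpeed ≠ 0)
    (hheight : Continuous fun p : X × ℝ => (w p.1).height p.2)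
    (hweight : Continuous fun p : X × ℝ => (w p.1).weight p.2)
    (hκ : Continuous fun s => (w s).κ) (c : ℝ) :
    Continuous fun p : X × ℝ => (w p.1).profile c p.2 := by
  have hdensity : Continuous fun p : X × ℝ => (w p.1).density p.2 :=
    hheight.div hweight.sqrt fun p => ((hw p.1).sqrt_weight_pos p.2).ne'
  have hmass : Continuous fun s => (w s).mass :=
    intervalIntegral.continuous_parametric_intervalIntegral_of_continuous' hdensity 0 π
  have hmoment : Continuous fun s => (w s).moment :=
    intervalIntegral.continuous_parametric_intervalIntegral_of_continuous'
      (f := fun s θ => (w s).height θ * (w s).density θ) (hheight.mul hdensity) 0 π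
  have hmass_ne : ∀ s, (w s).mass ≠ 0 := fun s => (hw s).mass_pos.ne'
  have hrate : Continuous fun p : X × ℝ => (w p.1).rate p.2 :=
    hdensity.div (hmass.comp continuous_fst) fun p => hmass_ne p.1
  have hphase : Continuous fun p : X × ℝ => phase (w p.1).rate p.2 :=
    continuous_phase_uncurry (fun s => (hw s).isClock) fun θ =>
      intervalIntegral.continuous_parametric_intervalIntegral_of_continuous' hrate 0 θ
  have hunitSpeed : Continuous fun s => (w s).unitSpeed :=
    ((continuous_const.mul hκ).mul (hmass.pow 2)).add (hmoment.div hmass hmass_ne)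
  have hscale : Continuous fun s => (w s).scale c := continuous_const.div hunitSpeed hunit
  exact continuous_const.sub <| (hscale.comp continuous_fst).mul <|
    hheight.comp (continuous_fst.prodMk hphase)

end WaveData

/-- The phase functions `a + b sin² θ` from which the waves are built; they oscillate between `a`
and `a + b`. -/
noncomputable def shape (a b θ : ℝ) : ℝ := a + b * Real.sin θ ^ 2

theorem contDiff_shape (a b : ℝ) : ContDiff ℝ ∞ (shape a b) :=
  contDiff_const.add (contDiff_const.mul (Real.contDiff_sin.pow 2))

theorem continuous_shape_uncurry : Continuous fun p : ℝ × ℝ × ℝ => shape p.1 p.2.1 p.2.2 := by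
  unfold shape
  fun_prop

theorem periodic_shape (a b : ℝ) : Function.Periodic (shape a b) π := fun θ => by
  simp [shape, Real.sin_add_pi]

theorem deriv_shape (a b θ : ℝ) :
    deriv (shape a b) θ = 2 * b * Real.sin θ * Real.cos θ := by
  refine ((((Real.hasDerivAt_sin θ).pow 2).const_mul b).const_add a).deriv.trans ?_
  push_cast
  ring

theorem deriv_shape_sq (a b θ : ℝ) :
    deriv (shape a b) θ ^ 2 = 4 * (shape a b θ - a) * (a + b - shape a b θ) := by
  rw [deriv_shape, shape]
  linear_combination 4 * b ^ 2 * Real.sin θ ^ 2 * Real.cos_sq' θ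

theorem countable_critical_shape (a : ℝ) {b : ℝ} (hb : b ≠ 0) :
    {θ | deriv (shape a b) θ = 0}.Countable := by
  refine (countable_range fun n : ℤ => n * π / 2).mono fun θ (hθ : deriv (shape a b) θ = 0) => ?_
  have hsin : Real.sin (2 * θ) = 0 := by
    rw [Real.sin_two_mul]
    exact mul_left_cancel₀ hb (by linear_combination (deriv_shape a b θ).symm.trans hθ)
  obtain ⟨n, hn⟩ := Real.sin_eq_zero_iff.1 hsin
  exact ⟨n, by linear_combination hn / 2⟩

theorem shape_one_pos {s : ℝ} (hs : -1 < s) (θ : ℝ) : 0 < shape 1 s θ := by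
  unfold shape
  rcases le_or_gt 0 s with h | h
  · positivity
  · nlinarith [Real.sin_sq_le_one θ]

theorem range_shape (a : ℝ) {b : ℝ} (hb : 0 ≤ b) : range (shape a b) = Icc a (a + b) := by
  refine Subset.antisymm ?_ fun y hy => ?_
  · rintro _ ⟨θ, rfl⟩
    exact ⟨le_add_of_nonneg_right (by positivity),
      add_le_add_right (mul_le_of_le_one_right hb (Real.sin_sq_le_one θ)) a⟩
  · exact mem_range_of_exists_le_of_exists_ge (contDiff_shape a b).continuous
      ⟨0, by simpa [shape] using hy.1⟩ ⟨π / 2, by simpa [shape] using hy.2⟩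

theorem IsClock.shape_eq_of_translate {g g' : ℝ → ℝ} (hg : IsClock g) (hg' : IsClock g')
    {a a' b b' h : ℝ} (hb : 0 ≤ b) (hb' : 0 ≤ b')
    (heq : ∀ x, shape a' b' (phase g' x) = shape a b (phase g (x + h))) : a' = a ∧ b' = b := by
  have hrange : range (shape a' b') = range (shape a b) := by
    rw [← hg'.surjective_phase.range_comp (shape a' b'),
      ← (hg.surjective_phase.comp (add_right_surjective h)).range_comp (shape a b)]
    exact congr_arg range (funext heq)
  rw [range_shape a' hb', range_shape a hb, Icc_eq_Icc_iff (le_add_of_nonneg_right hb')] at hrange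
  exact ⟨hrange.1, by linarith [hrange.1, hrange.2]⟩

/-- The data of the smooth waves. The energy is `4 (y - 1) (1 + s - y)`: for `0 < s` the height
oscillates between its two simple roots. -/
noncomputable def smoothData (s : ℝ) : WaveData :=
  ⟨shape 1 s, shape 1 s, -4 * (1 + s), 4 * (2 + s), 1⟩

theorem isAdmissible_smoothData {s : ℝ} (hs : -1 < s) (hs₀ : s ≠ 0) :
    (smoothData s).IsAdmissible where
  contDiff_height := contDiff_shape 1 s
  contDiff_weight := contDiff_shape 1 s
  periodic_height := periodic_shape 1 s
  periodic_weight := periodic_shape 1 s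
  height_nonneg θ := (shape_one_pos hs θ).le
  weight_pos := shape_one_pos hs
  countable_critical := countable_critical_shape 1 hs₀
  firstIntegral θ := by
    simp only [smoothData, WaveData.energy, deriv_shape_sq]
    ring

theorem isSmoothWave_smoothData {c s : ℝ} (hc : c ≠ 0) (hs : -1 < s) (hs₀ : s ≠ 0) :
    IsSmoothWave c ((smoothData s).profile c) := by
  have hw := isAdmissible_smoothData hs hs₀
  exact hw.isSmoothWave_profile hc (hw.unitSpeed_pos zero_le_one).ne'
    (fun θ hθ => by simpa [smoothData, shape, hs₀] using hθ) (shape_one_pos hs)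

theorem eq_of_translate_smoothData {c s s' h : ℝ} (hc : c ≠ 0) (hs : 0 < s) (hs' : 0 < s')
    (heq : ∀ x, (smoothData s').profile c x = (smoothData s).profile c (x + h)) : s' = s := by
  have hw := isAdmissible_smoothData (by linarith) hs.ne'
  have hw' := isAdmissible_smoothData (by linarith) hs'.ne'
  have hd := hw.unitSpeed_pos zero_le_one
  have hd' := hw'.unitSpeed_pos zero_le_one
  have hshape : ∀ x, shape (1 / (smoothData s').unitSpeed) (s' / (smoothData s').unitSpeed)
      (phase (smoothData s').rate x) =
      shape (1 / (smoothData s).unitSpeed) (s / (smoothData s).unitSpeed)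
        (phase (smoothData s).rate (x + h)) := fun x => by
    refine mul_left_cancel₀ hc ?_
    have hx : c - c / (smoothData s').unitSpeed * shape 1 s' (phase (smoothData s').rate x) =
      c - c / (smoothData s).unitSpeed * shape 1 s (phase (smoothData s).rate (x + h)) := heq x
    unfold shape at hx ⊢
    linear_combination -hx
  obtain ⟨hunit, hratio⟩ := hw.isClock.shape_eq_of_translate hw'.isClock
    (div_pos hs hd).le (div_pos hs' hd').le hshape
  rw [one_div, one_div, inv_inj] at hunit
  rwa [hunit, div_left_inj' hd.ne'] at hratio

theorem isOneParameterFamily_smoothData {c : ℝ} (hc : c ≠ 0) :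
    IsOneParameterFamily (IsSmoothWave c) fun s => (smoothData s).profile c := by
  have hw : ∀ s : Ioo (0 : ℝ) 1, (smoothData s).IsAdmissible := fun s =>
    isAdmissible_smoothData (by linarith [s.2.1]) s.2.1.ne'
  refine ⟨fun s hs => isSmoothWave_smoothData hc (by linarith [hs.1]) hs.1.ne', ?_,
    fun s hs s' hs' hne ⟨h, heq⟩ => hne (eq_of_translate_smoothData hc hs.1 hs'.1 heq).symm⟩
  have hshape : Continuous fun p : Ioo (0 : ℝ) 1 × ℝ => shape 1 p.1 p.2 :=
    continuous_shape_uncurry.comp (by fun_prop : Continuous fun p : Ioo (0 : ℝ) 1 × ℝ =>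
      ((1 : ℝ), (p.1 : ℝ), p.2))
  exact continuousOn_prod_univ (f := fun s => (smoothData s).profile c) <|
    WaveData.continuous_profile_uncurry hw (fun s => ((hw s).unitSpeed_pos zero_le_one).ne')
      hshape hshape continuous_const c

/-- The data of the cusped waves. The energy is `4 (1 - y) (1 + s y)`: the height oscillates between
its simple root `1` and the singular value `0`, which is taken at the cusps. -/
noncomputable def cuspData (s : ℝ) : WaveData := ⟨shape 0 1, shape 1 s, 4, 4 * (s - 1), s⟩

theorem isAdmissible_cuspData {s : ℝ} (hs : -1 < s) : (cuspData s).IsAdmissible where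
  contDiff_height := contDiff_shape 0 1
  contDiff_weight := contDiff_shape 1 s
  periodic_height := periodic_shape 0 1
  periodic_weight := periodic_shape 1 s
  height_nonneg θ := by simp [cuspData, shape, sq_nonneg]
  weight_pos := shape_one_pos hs
  countable_critical := countable_critical_shape 0 one_ne_zero
  firstIntegral θ := by
    simp only [cuspData, WaveData.energy, deriv_shape_sq]
    unfold shape
    ring

theorem height_cuspData (s θ : ℝ) : (cuspData s).height θ = Real.sin θ ^ 2 := by
  simp [cuspData, shape]

theorem height_cuspData_ne_zero_iff {s θ : ℝ} : (cuspData s).height θ ≠ 0 ↔ Real.sin θ ≠ 0 := by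
  simp [height_cuspData]

theorem profile_cuspData (c s x : ℝ) : (cuspData s).profile c x =
    c - (cuspData s).scale c * Real.sin (phase (cuspData s).rate x) ^ 2 := by
  simp [WaveData.profile, height_cuspData]

theorem profile_cuspData_eq_iff {c s x : ℝ} (hq : (cuspData s).scale c ≠ 0) :
    (cuspData s).profile c x = c ↔ Real.sin (phase (cuspData s).rate x) = 0 := by
  simp [profile_cuspData, hq]

theorem slope_cuspData (c s θ : ℝ) : (cuspData s).slope c θ =
    -(2 * (cuspData s).scale c * (cuspData s).mass) * √(shape 1 s θ) * Real.cos θ *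
      (Real.sin θ)⁻¹ := by
  have hderiv : deriv (cuspData s).height θ = 2 * Real.sin θ * Real.cos θ :=
    (deriv_shape 0 1 θ).trans (by ring)
  have hweight : (cuspData s).weight θ = shape 1 s θ := rfl
  rw [WaveData.slope, hderiv, height_cuspData, hweight]
  rcases eq_or_ne (Real.sin θ) 0 with h | h
  · simp [h]
  · field_simp

theorem tendsto_sin_nhdsLT_zero : Tendsto Real.sin (𝓝[<] 0) (𝓝[<] 0) := by
  refine tendsto_nhdsWithin_iff.2
    ⟨by simpa using Real.continuous_sin.continuousWithinAt.tendsto (x := 0), ?_⟩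
  filter_upwards [Ioo_mem_nhdsLT (neg_neg_of_pos Real.pi_pos)] with θ hθ
  exact Real.sin_neg_of_neg_of_neg_pi_lt hθ.2 hθ.1

theorem tendsto_sin_nhdsGT_zero : Tendsto Real.sin (𝓝[>] 0) (𝓝[>] 0) := by
  refine tendsto_nhdsWithin_iff.2
    ⟨by simpa using Real.continuous_sin.continuousWithinAt.tendsto (x := 0), ?_⟩
  filter_upwards [Ioo_mem_nhdsGT Real.pi_pos] with θ hθ
  exact Real.sin_pos_of_pos_of_lt_pi hθ.1 hθ.2

section

variable {c s : ℝ}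

theorem tendsto_slope_coefficient_cuspData :
    Tendsto (fun θ => -(2 * (cuspData s).scale c * (cuspData s).mass) * √(shape 1 s θ) *
      Real.cos θ) (𝓝 0) (𝓝 (-(2 * (cuspData s).scale c * (cuspData s).mass))) := by
  have hcont : Continuous fun θ => -(2 * (cuspData s).scale c * (cuspData s).mass) *
      √(shape 1 s θ) * Real.cos θ := by
    have := (contDiff_shape 1 s).continuous
    fun_prop
  simpa [shape] using hcont.tendsto 0

theorem slope_coefficient_cuspData_neg (hs : -1 < s) (hq : 0 < (cuspData s).scale c) :
    -(2 * (cuspData s).scale c * (cuspData s).mass) < 0 :=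
  neg_neg_of_pos (mul_pos (mul_pos two_pos hq) (isAdmissible_cuspData hs).mass_pos)

theorem tendsto_slope_cuspData_nhdsLT (hs : -1 < s) (hq : 0 < (cuspData s).scale c) :
    Tendsto ((cuspData s).slope c) (𝓝[<] 0) atTop := by
  simp only [funext fun θ => slope_cuspData c s θ]
  exact (tendsto_slope_coefficient_cuspData.mono_left nhdsWithin_le_nhds).neg_mul_atBot
    (slope_coefficient_cuspData_neg hs hq) (tendsto_inv_nhdsLT_zero.comp tendsto_sin_nhdsLT_zero)

theorem tendsto_slope_cuspData_nhdsGT (hs : -1 < s) (hq : 0 < (cuspData s).scale c) :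
    Tendsto ((cuspData s).slope c) (𝓝[>] 0) atBot := by
  simp only [funext fun θ => slope_cuspData c s θ]
  exact (tendsto_slope_coefficient_cuspData.mono_left nhdsWithin_le_nhds).neg_mul_atTop
    (slope_coefficient_cuspData_neg hs hq) (tendsto_inv_nhdsGT_zero.comp tendsto_sin_nhdsGT_zero)

theorem height_phase_cuspData_ne_zero (hs : -1 < s) {x : ℝ} (hx : |x| < 1) (hx₀ : x ≠ 0) :
    (cuspData s).height (phase (cuspData s).rate x) ≠ 0 := by
  rw [height_cuspData_ne_zero_iff, Ne, (isAdmissible_cuspData hs).isClock.sin_phase_eq_zero_iff]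
  rintro ⟨n, rfl⟩
  exact hx₀ (by exact_mod_cast Int.abs_lt_one_iff.1 (by exact_mod_cast hx))

theorem hasCuspAt_zero_cuspData (hs : -1 < s) (hq : 0 < (cuspData s).scale c) :
    HasCuspAt ((cuspData s).profile c) 0 := by
  have hw := isAdmissible_cuspData hs
  have hleft : ∀ x ∈ Ioo (-1 : ℝ) 0, (cuspData s).height (phase (cuspData s).rate x) ≠ 0 :=
    fun x hx => height_phase_cuspData_ne_zero hs (abs_lt.2 ⟨hx.1, hx.2.trans one_pos⟩) hx.2.ne
  have hright : ∀ x ∈ Ioo (0 : ℝ) 1, (cuspData s).height (phase (cuspData s).rate x) ≠ 0 :=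
    fun x hx =>
      height_phase_cuspData_ne_zero hs (abs_lt.2 ⟨neg_one_lt_zero.trans hx.1, hx.2⟩) hx.1.ne'
  refine ⟨(hw.continuous_profile c).continuousAt, ⟨1, one_pos, ?_, ?_⟩, ?_, ?_⟩
  · rw [zero_sub]
    exact fun x hx => (hw.contDiffAt_profile c (hleft x hx)).contDiffWithinAt
  · rw [zero_add]
    exact fun x hx => (hw.contDiffAt_profile c (hright x hx)).contDiffWithinAt
  · refine ((tendsto_slope_cuspData_nhdsLT hs hq).comp
      hw.isClock.tendsto_phase_nhdsLT_zero).congr' ?_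
    filter_upwards [Ioo_mem_nhdsLT neg_one_lt_zero] with x hx
    exact (hw.hasDerivAt_profile c (hleft x hx)).deriv.symm
  · refine ((tendsto_slope_cuspData_nhdsGT hs hq).comp
      hw.isClock.tendsto_phase_nhdsGT_zero).congr' ?_
    filter_upwards [Ioo_mem_nhdsGT one_pos] with x hx
    exact (hw.hasDerivAt_profile c (hright x hx)).deriv.symm

theorem isCuspedWave_cuspData (hs : -1 < s) (hq : 0 < (cuspData s).scale c) :
    IsCuspedWave c ((cuspData s).profile c) := by
  have hw := isAdmissible_cuspData hs
  obtain ⟨hc, hunit⟩ := div_ne_zero_iff.1 hq.ne'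
  have hcrest : ∀ x, (cuspData s).profile c x = c ↔ ∃ n : ℤ, x = n := fun x =>
    (profile_cuspData_eq_iff hq.ne').trans hw.isClock.sin_phase_eq_zero_iff
  refine ⟨hw.isPeriodOneWave_profile hc hunit fun θ hθ => by simpa [height_cuspData] using hθ,
    fun x => ?_, ⟨0, by simpa using hcrest⟩, fun x hx => ?_, fun x hx => ?_⟩
  · rw [profile_cuspData]
    exact sub_le_self c (by positivity)
  · obtain ⟨n, rfl⟩ := (hcrest x).1 hx
    have hshift : (fun x => (cuspData s).profile c (x - n)) = (cuspData s).profile c :=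
      funext fun x => by simpa using (hw.periodic_profile c).sub_zsmul_eq n
    simpa [hshift] using (hasCuspAt_zero_cuspData hs hq).comp_sub_const n
  · exact (hw.contDiffAt_profile c (height_cuspData_ne_zero_iff.2 fun h =>
      hx ((profile_cuspData_eq_iff hq.ne').2 h))).contDiffWithinAt

theorem deriv_profile_cuspData_sq_of_half_height (hs : -1 < s) {x : ℝ}
    (hx : Real.sin (phase (cuspData s).rate x) ^ 2 = 1 / 2) :
    deriv ((cuspData s).profile c) x ^ 2 =
      2 * (cuspData s).scale c ^ 2 * ((2 + s) * (cuspData s).mass ^ 2) := by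
  have hheight := (height_cuspData s _).trans hx
  have h := (isAdmissible_cuspData hs).height_mul_sq_deriv_profile c
    (by rw [hheight]; norm_num : (cuspData s).height (phase (cuspData s).rate x) ≠ 0)
  rw [hheight, show (cuspData s).energy (1 / 2) = 2 + s by
    simp only [WaveData.energy, cuspData]; ring] at h
  linear_combination 2 * h

theorem scale_cuspData_eq_of_translate {s' h : ℝ} (hs : -1 < s) (hs' : -1 < s')
    (hq : 0 ≤ (cuspData s).scale c) (hq' : 0 ≤ (cuspData s').scale c)
    (heq : ∀ x, (cuspData s').profile c x = (cuspData s).profile c (x + h)) :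
    (cuspData s').scale c = (cuspData s).scale c := by
  refine ((isAdmissible_cuspData hs).isClock.shape_eq_of_translate (a := 0) (a' := 0) (h := h)
    (isAdmissible_cuspData hs').isClock hq hq' fun x => ?_).2
  have hx := heq x
  rw [profile_cuspData, profile_cuspData] at hx
  unfold shape
  linear_combination -hx

/-- The range of the profile determines the scale; the mean and the slope at half height then
determine `s * mass ^ 2` and `(2 + s) * mass ^ 2`. -/
theorem eq_of_translate_cuspData {s' h : ℝ} (hs : -1 < s) (hs' : -1 < s')
    (hq : 0 < (cuspData s).scale c) (hq' : 0 < (cuspData s').scale c)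
    (heq : ∀ x, (cuspData s').profile c x = (cuspData s).profile c (x + h)) : s' = s := by
  have hw := isAdmissible_cuspData hs
  have hw' := isAdmissible_cuspData hs'
  have hscale := scale_cuspData_eq_of_translate hs hs' hq.le hq'.le heq
  have hmean : s' * (cuspData s').mass ^ 2 = s * (cuspData s).mass ^ 2 := by
    have hmean := congr_arg mean (funext heq)
    rw [mean_comp_add_const (hw.periodic_profile c),
      hw.mean_profile (div_ne_zero_iff.1 hq.ne').2,
      hw'.mean_profile (div_ne_zero_iff.1 hq'.ne').2, hscale] at hmean
    refine mul_left_cancel₀ (mul_pos two_pos hq).ne' ?_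
    simp only [cuspData] at hmean ⊢
    linear_combination hmean
  have hslope : (2 + s') * (cuspData s').mass ^ 2 = (2 + s) * (cuspData s).mass ^ 2 := by
    obtain ⟨x, hx⟩ := hw'.isClock.surjective_phase (π / 4)
    have hhalf' : Real.sin (phase (cuspData s').rate x) ^ 2 = 1 / 2 := by
      rw [hx, Real.sin_pi_div_four, div_pow, Real.sq_sqrt two_pos.le]
      norm_num
    have hhalf : Real.sin (phase (cuspData s).rate (x + h)) ^ 2 = 1 / 2 := by
      have h := heq x
      rw [profile_cuspData, profile_cuspData, hscale] at h
      rw [← hhalf']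
      exact mul_left_cancel₀ hq.ne' (by linear_combination h)
    have hderiv : deriv ((cuspData s').profile c) x = deriv ((cuspData s).profile c) (x + h) := by
      rw [funext heq, deriv_comp_add_const]
    have hsq := congr_arg (· ^ 2) hderiv
    simp only [deriv_profile_cuspData_sq_of_half_height hs' hhalf',
      deriv_profile_cuspData_sq_of_half_height hs hhalf, hscale] at hsq
    exact mul_left_cancel₀ (mul_pos two_pos (pow_pos hq 2)).ne' hsq
  have hmass : (cuspData s').mass ^ 2 = (cuspData s).mass ^ 2 := by linarith
  rw [hmass] at hmean
  exact mul_right_cancel₀ (pow_pos hw.mass_pos 2).ne' hmean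

end

theorem unitSpeed_cuspData_neg {s : ℝ} (hs : -1 < s) (hs' : s ≤ -1 / 2) :
    (cuspData s).unitSpeed < 0 := by
  have hw := isAdmissible_cuspData hs
  have hdensity := hw.contDiff_density.continuous
  have hmass := hw.mass_pos
  have hmoment_le : (cuspData s).moment / (cuspData s).mass ≤ 1 := by
    refine (div_le_one hmass).2 <| intervalIntegral.integral_mono_on Real.pi_pos.le
      ((hw.contDiff_height.continuous.mul hdensity).intervalIntegrable _ _)
      (hdensity.intervalIntegrable _ _) fun θ _ => ?_
    rw [height_cuspData]
    exact mul_le_of_le_one_left (hw.density_nonneg θ) (Real.sin_sq_le_one θ)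
  have hmass_ge : π / 2 ≤ (cuspData s).mass := by
    rw [show π / 2 = ∫ θ in (0 : ℝ)..π, Real.sin θ ^ 2 by simp [integral_sin_sq]]
    refine intervalIntegral.integral_mono_on Real.pi_pos.le
      (Continuous.intervalIntegrable (by fun_prop) _ _) (hdensity.intervalIntegrable _ _)
      fun θ _ => ?_
    rw [WaveData.density, height_cuspData]
    refine le_div_self (sq_nonneg _) (hw.sqrt_weight_pos θ) (Real.sqrt_le_one.2 ?_)
    exact add_le_of_nonpos_right (mul_nonpos_of_nonpos_of_nonneg (by linarith) (sq_nonneg _))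
  have hone_lt : 1 < (cuspData s).mass := by linarith [Real.pi_gt_three]
  rw [WaveData.unitSpeed, show (cuspData s).κ = s from rfl]
  nlinarith

theorem isOneParameterFamily_cuspData {c : ℝ} {σ : ℝ → ℝ} (hσ : Continuous σ)
    (hinj : Function.Injective σ) (hσ₁ : ∀ s ∈ Ioo (0 : ℝ) 1, -1 < σ s)
    (hq : ∀ s ∈ Ioo (0 : ℝ) 1, 0 < (cuspData (σ s)).scale c) :
    IsOneParameterFamily (IsCuspedWave c) fun s => (cuspData (σ s)).profile c := by
  refine ⟨fun s hs => isCuspedWave_cuspData (hσ₁ s hs) (hq s hs), ?_,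
    fun s hs s' hs' hne ⟨h, heq⟩ => hne (hinj (eq_of_translate_cuspData (hσ₁ s hs)
      (hσ₁ s' hs') (hq s hs) (hq s' hs') heq)).symm⟩
  have hheight : Continuous fun p : Ioo (0 : ℝ) 1 × ℝ => shape 0 1 p.2 :=
    (contDiff_shape 0 1).continuous.comp continuous_snd
  have hweight : Continuous fun p : Ioo (0 : ℝ) 1 × ℝ => shape 1 (σ p.1) p.2 :=
    continuous_shape_uncurry.comp (by fun_prop : Continuous fun p : Ioo (0 : ℝ) 1 × ℝ =>
      ((1 : ℝ), σ p.1, p.2))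
  exact continuousOn_prod_univ (f := fun s => (cuspData (σ s)).profile c) <|
    WaveData.continuous_profile_uncurry
      (fun s : Ioo (0 : ℝ) 1 => isAdmissible_cuspData (hσ₁ s s.2))
      (fun s => (div_ne_zero_iff.1 (hq s s.2).ne').2) hheight hweight
      (hσ.comp continuous_subtype_val) c

theorem exists_isOneParameterFamily_isCuspedWave {c : ℝ} (hc : c ≠ 0) :
    ∃ Φ : ℝ → ℝ → ℝ, IsOneParameterFamily (IsCuspedWave c) Φ := by
  rcases hc.lt_or_gt with hc | hc
  · refine ⟨_, isOneParameterFamily_cuspData (σ := fun s => s / 2 - 1) (by fun_prop)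
      (fun s s' h => by simpa using h) (fun s hs => by linarith [hs.1]) fun s hs => ?_⟩
    exact div_pos_of_neg_of_neg hc
      (unitSpeed_cuspData_neg (by linarith [hs.1]) (by linarith [hs.2]))
  · refine ⟨_, isOneParameterFamily_cuspData continuous_id Function.injective_id
      (fun s hs => neg_one_lt_zero.trans hs.1) fun s hs => div_pos hc ?_⟩
    exact (isAdmissible_cuspData (neg_one_lt_zero.trans hs.1)).unitSpeed_pos hs.1.le

end MuHS

theorem mainTheorem8 (c : ℝ) (hc : c ≠ 0) :
    (∃ Φ : ℝ → ℝ → ℝ, MuHS.IsOneParameterFamily (MuHS.IsSmoothWave c) Φ) ∧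
      (∃ Φ : ℝ → ℝ → ℝ, MuHS.IsOneParameterFamily (MuHS.IsCuspedWave c) Φ) :=
  ⟨⟨_, MuHS.isOneParameterFamily_smoothData hc⟩, MuHS.exists_isOneParameterFamily_isCuspedWave hc⟩
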